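/- Let $d \ge 1$ be an integer and $\eta > 0$. Let $G$ be a random $d\times d$ matrix with independent $\mathcal N(0,1)$ entries, and let $\mathbb S^d_{>0}$ be the set of real symmetric positive definite $d\times d$ matrices. For $\Sigma_1,\Sigma_2\in\mathbb S^d_{>0}$ put $$\mathrm{dist}(\Sigma_1,\Sigma_2)=\max\{\|\Sigma_1^{-1/2}\Sigma_2\Sigma_1^{-1/2}-I\|,\ \|\Sigma_2^{-1/2}\Sigma_1\Sigma_2^{-1/2}-I\|\},$$ where $\|\cdot\|$ is the spectral norm, and for $\Sigma\in\mathbb S^d_{>0}$ put $$\mathcal B(\Sigma)=\Sigma^{1/2}(I+\eta G)(I+\eta G)^\top\Sigma^{1/2}.$$ Two random variables $X, Y$ are called $(\varepsilon,\delta)$-indistinguishable if $\Pr[X\in S]\le e^{\varepsilon}\Pr[Y\in S]+\delta$ and $\Pr[Y\in S]\le e^{\varepsilon}\Pr[X\in S]+\delta$ for every measurable set $S$. A randomized map $\mathcal B$ from $\mathbb S^d_{>0}$ to itself (that is, $\mathcal B(\Sigma)\in\mathbb S^d_{>0}$ almost surely for each $\Sigma$) is called a $(\gamma,\varepsilon,\delta)$-masking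 mechanism if $\mathcal B(\Sigma_1)$ and $\mathcal B(\Sigma_2)$ are $(\varepsilon,\delta)$-indistinguishable whenever $\mathrm{dist}(\Sigma_1,\Sigma_2)\le\gamma$. 1. Let $\Sigma_1,\Sigma_2\in\mathbb S^d_{>0}$ satisfy $\mathrm{dist}(\Sigma_1,\Sigma_2)\le\gamma\le 1/2$. Then for every $\delta_0>0$, the random matrices $\Sigma_1^{1/2}(I+\eta G)$ and $\Sigma_2^{1/2}(I+\eta G)$ are $(\varepsilon_0(\delta_0),\delta_0)$-indistinguishable, and so are $\mathcal B(\Sigma_1)$ and $\mathcal B(\Sigma_2)$, where $$\varepsilon_0(\delta_0)=\frac{\gamma^2 d}{2}\Bigl(d+\frac1{\eta^2}\Bigr)+2d\gamma\sqrt{\ln(2/\delta_0)}+2\gamma\ln(2/\delta_0)+\frac{3\gamma\sqrt d\,\sqrt{\ln(2/\delta_0)}}{\eta}$$ (with the convention $\sqrt{x}=0$ for $x<0$, which matters only in the trivial case $\delta_0>2$). 2. For all $\varepsilon,\delta\in(0,1]$, the map $\mathcal B$ is a $(\gamma,\varepsilon,\delta)$-masking mechanism, where $$\gamma=\min\left\{\sqrt{\frac{\varepsilon}{2d(d+1/\eta^2)}},\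 \frac{\varepsilon}{8d\sqrt{\ln(2/\delta)}},\ \frac{\varepsilon}{8\ln(2/\delta)},\ \frac{\varepsilon\eta}{12\sqrt d\,\sqrt{\ln(2/\delta)}}\right\}.$$ -/

import Mathlib

open MeasureTheory ProbabilityTheory Matrix
open scoped ENNReal MatrixOrder Matrix.Norms.L2Operator

noncomputable section

namespace CovMask

/-- Matrices carry the product σ-algebra of their entries (equivalently, the Borel σ-algebra). -/
instance instMeasurableSpaceMatrix (d : ℕ) : MeasurableSpace (Matrix (Fin d) (Fin d) ℝ) :=
  inferInstanceAs (MeasurableSpace (Fin d → Fin d → ℝ))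

/-- Two distributions are `(ε, δ)`-indistinguishable if `μ S ≤ e^ε ν S + δ` and
`ν S ≤ e^ε μ S + δ` for every measurable set `S`. -/
def Indistinguishable {Z : Type*} [MeasurableSpace Z] (μ ν : Measure Z) (ε δ : ℝ) : Prop :=
  ∀ S : Set Z, MeasurableSet S →
    μ S ≤ ENNReal.ofReal (Real.exp ε) * ν S + ENNReal.ofReal δ ∧
    ν S ≤ ENNReal.ofReal (Real.exp ε) * μ S + ENNReal.ofReal δ

/-- A randomized map of `Y ⊆ Z` to itself, given by the law `B y` of its output at `y ∈ Y`, is a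
`(γ, ε, δ)`-masking mechanism for `(Y, dist)` if its outputs at any two points of `Y` at
distance at most `γ` are `(ε, δ)`-indistinguishable. -/
def IsMaskingMechanism {Z : Type*} [MeasurableSpace Z] (Y : Set Z) (dist : Z → Z → ℝ)
    (B : Z → Measure Z) (γ ε δ : ℝ) : Prop :=
  (∀ y ∈ Y, IsProbabilityMeasure (B y) ∧ ∀ᵐ z ∂(B y), z ∈ Y) ∧
  ∀ y₁ ∈ Y, ∀ y₂ ∈ Y, dist y₁ y₂ ≤ γ → Indistinguishable (B y₁) (B y₂) ε δ

variable {d : ℕ}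

/-- The spectral distance
`max (‖A^{-1/2} B A^{-1/2} - I‖) (‖B^{-1/2} A B^{-1/2} - I‖)` of positive definite matrices,
in the `ℓ²` operator norm. -/
def specDist (A B : Matrix (Fin d) (Fin d) ℝ) : ℝ :=
  max ‖(CFC.sqrt A)⁻¹ * B * (CFC.sqrt A)⁻¹ - 1‖ ‖(CFC.sqrt B)⁻¹ * A * (CFC.sqrt B)⁻¹ - 1‖

/-- The law of a `d × d` matrix with independent `N(0, 1)` entries. -/
def gaussianMatrix (d : ℕ) : Measure (Matrix (Fin d) (Fin d) ℝ) :=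
  (Measure.pi fun _ : Fin d × Fin d => gaussianReal 0 1).map fun g => Matrix.of fun i j => g (i, j)

/-- The law of `Σ^{1/2} (I + η G)`. -/
def noisyFactor (η : ℝ) (A : Matrix (Fin d) (Fin d) ℝ) : Measure (Matrix (Fin d) (Fin d) ℝ) :=
  (gaussianMatrix d).map fun G => CFC.sqrt A * (1 + η • G)

/-- The law of `Σ^{1/2} (I + η G) (I + η G)ᵀ Σ^{1/2}`. -/
def covMechanism (η : ℝ) (A : Matrix (Fin d) (Fin d) ℝ) : Measure (Matrix (Fin d) (Fin d) ℝ) :=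
  (gaussianMatrix d).map fun G => CFC.sqrt A * (1 + η • G) * (1 + η • G)ᵀ * CFC.sqrt A

/-- The privacy parameter `ε₀(δ₀)`. -/
def epsZero (d : ℕ) (η γ δ₀ : ℝ) : ℝ :=
  γ ^ 2 * d / 2 * (d + 1 / η ^ 2) + 2 * d * γ * √(Real.log (2 / δ₀)) + 2 * γ * Real.log (2 / δ₀)
    + 3 * γ * √d * √(Real.log (2 / δ₀)) / η

/-- The masking radius of the mechanism for privacy parameters `ε, δ`. -/
def maskRadius (d : ℕ) (η ε δ : ℝ) : ℝ :=
  min (min √(ε / (2 * d * (d + 1 / η ^ 2))) (ε / (8 * d * √(Real.log (2 / δ)))))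
    (min (ε / (8 * Real.log (2 / δ))) (ε * η / (12 * √d * √(Real.log (2 / δ)))))

end CovMask

end

/-! With P = Σ₂^{-1/2} Σ₁^{1/2}, one has Σ₁^{1/2}(I + ηG) = Σ₂^{1/2}(I + ηG') for G' = PG + (P -
I)/η. So it suffices to compare a standard Gaussian vector g with Mg + k, where M = P ⊗ I and k
lists the entries of (P - I)/η. The comparison reduces to a tail bound for the log-likelihood ratio
`privacyLoss` (`stdGauss_preimage_le`).

The eigenvalues D of MᵀM are those of PPᵀ = Σ₂^{-1/2} Σ₁ Σ₂^{-1/2}, hence within γ of 1. In an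
orthonormal eigenbasis the loss is a sum of independent quadratics in one Gaussian variable each.
Its first-order terms in D - 1 cancel against log |det M|, so its mean is O(γ²), and a Chernoff
bound gives a sub-gamma tail (`measure_privacyLoss_gt_le`). The shift is controlled by ‖P - I‖_F² ≤
dγ² (`sum_sq_inv_mul_sub_one_le`).

The mechanism is the image of the noisy factor under Z ↦ ZZᵀ, and post-processing preserves
indistinguishability. For the masking radius, each of the four terms of ε₀ is at most ε/4; outputs
are almost surely positive definite because I + ηG is almost surely invertible. -/

namespace CovMask

/-! ### The standard Gaussian measure and affine changes of variables -/

section Gaussian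

variable {ι : Type*} [Fintype ι]

/-- The standard Gaussian measure on `ι → ℝ`. -/
noncomputable abbrev stdGauss (ι : Type*) [Fintype ι] : Measure (ι → ℝ) :=
  Measure.pi fun _ : ι => gaussianReal 0 1

/-- The Lebesgue density of `stdGauss`. -/
noncomputable def stdDensity (g : ι → ℝ) : ℝ :=
  ∏ i, gaussianPDFReal 0 1 (g i)

lemma measurable_stdDensity : Measurable (stdDensity : (ι → ℝ) → ℝ) := by
  unfold stdDensity
  exact Finset.measurable_prod _ fun i _ =>
    (measurable_gaussianPDFReal 0 1).comp (measurable_pi_apply i)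

lemma stdDensity_eq (g : ι → ℝ) :
    stdDensity g = (√(2 * Real.pi))⁻¹ ^ Fintype.card ι * Real.exp (-(g ⬝ᵥ g) / 2) := by
  unfold stdDensity gaussianPDFReal
  rw [Finset.prod_mul_distrib, ← Real.exp_sum]
  simp only [NNReal.coe_one, mul_one, sub_zero, Finset.prod_const, Finset.card_univ, dotProduct]
  congr 2
  rw [← Finset.sum_div, Finset.sum_neg_distrib]
  simp only [sq]

lemma stdDensity_pos (g : ι → ℝ) : 0 < stdDensity g :=
  Finset.prod_pos fun _ _ => gaussianPDFReal_pos _ _ _ one_ne_zero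

lemma stdGauss_eq_withDensity :
    stdGauss ι = volume.withDensity fun g => ENNReal.ofReal (stdDensity g) := by
  refine Measure.pi_eq fun s hs => ?_
  rw [withDensity_apply _ (MeasurableSet.univ_pi hs)]
  have hint : ∀ i, Integrable ((s i).indicator (gaussianPDFReal 0 1)) := fun i =>
    (integrable_gaussianPDFReal 0 1).indicator (hs i)
  have hprod : ∀ g : ι → ℝ, (Set.univ.pi s).indicator stdDensity g
      = ∏ i, (s i).indicator (gaussianPDFReal 0 1) (g i) := by
    intro g
    by_cases hg : g ∈ Set.univ.pi s
    · rw [Set.indicator_of_mem hg]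
      exact Finset.prod_congr rfl fun i _ => (Set.indicator_of_mem (hg i trivial) _).symm
    · rw [Set.indicator_of_notMem hg]
      simp only [Set.mem_pi, Set.mem_univ, true_imp_iff, not_forall] at hg
      obtain ⟨i, hi⟩ := hg
      exact (Finset.prod_eq_zero (Finset.mem_univ i) (Set.indicator_of_notMem hi _)).symm
  have hint' : Integrable ((Set.univ.pi s).indicator (stdDensity : (ι → ℝ) → ℝ)) := by
    simp_rw [funext hprod]
    exact Integrable.fintype_prod hint
  rw [← lintegral_indicator (MeasurableSet.univ_pi hs)]
  have h1 : ∀ g : ι → ℝ, (Set.univ.pi s).indicator (fun g => ENNReal.ofReal (stdDensity g)) g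
      = ENNReal.ofReal ((Set.univ.pi s).indicator stdDensity g) := by
    intro g
    by_cases hg : g ∈ Set.univ.pi s <;> simp [hg]
  simp_rw [h1]
  rw [← ofReal_integral_eq_lintegral_ofReal hint'
    (.of_forall fun g => Set.indicator_nonneg (fun g _ => (stdDensity_pos g).le) g)]
  simp_rw [hprod]
  rw [integral_fintype_prod_volume_eq_prod (fun i => (s i).indicator (gaussianPDFReal 0 1)),
    ENNReal.ofReal_prod_of_nonneg fun i _ => integral_nonneg fun x =>
      Set.indicator_nonneg (fun x _ => gaussianPDFReal_nonneg 0 1 x) x]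
  refine Finset.prod_congr rfl fun i _ => ?_
  rw [gaussianReal_apply_eq_integral 0 one_ne_zero, integral_indicator (hs i)]

lemma lintegral_stdGauss {f : (ι → ℝ) → ℝ≥0∞} (hf : Measurable f) :
    ∫⁻ g, f g ∂(stdGauss ι) = ∫⁻ g, ENNReal.ofReal (stdDensity g) * f g := by
  rw [stdGauss_eq_withDensity,
    lintegral_withDensity_eq_lintegral_mul _ measurable_stdDensity.ennreal_ofReal hf]
  rfl

/-- The log-likelihood ratio, at the point `g`, of the standard Gaussian law and its image under
the inverse of `g ↦ M g + k`. -/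
noncomputable def privacyLoss [DecidableEq ι] (M : Matrix ι ι ℝ) (k g : ι → ℝ) : ℝ :=
  -Real.log |M.det| + ((M *ᵥ g + k) ⬝ᵥ (M *ᵥ g + k) - g ⬝ᵥ g) / 2

lemma measurable_mulVec (M : Matrix ι ι ℝ) : Measurable fun g : ι → ℝ => M *ᵥ g :=
  (Continuous.matrix_mulVec continuous_const continuous_id).measurable

lemma measurable_privacyLoss [DecidableEq ι] (M : Matrix ι ι ℝ) (k : ι → ℝ) :
    Measurable (privacyLoss M k) := by
  have h : Continuous fun g : ι → ℝ => M *ᵥ g :=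
    Continuous.matrix_mulVec continuous_const continuous_id
  have : Continuous (privacyLoss M k) := by
    unfold privacyLoss
    exact continuous_const.add ((((h.add continuous_const).dotProduct
      (h.add continuous_const)).sub (continuous_id.dotProduct continuous_id)).div_const 2)
  exact this.measurable

lemma det_mul_stdDensity [DecidableEq ι] {M : Matrix ι ι ℝ} (hM : M.det ≠ 0) (k g : ι → ℝ) :
    |M.det| * stdDensity (M *ᵥ g + k) = stdDensity g * Real.exp (-privacyLoss M k g) := by
  rw [stdDensity_eq, stdDensity_eq, privacyLoss, mul_assoc, ← Real.exp_add]
  conv_lhs => rw [← Real.exp_log (abs_pos.2 hM)]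
  rw [mul_left_comm, ← Real.exp_add]
  congr 2
  ring

/-- Change of variables in a Gaussian integral along an invertible affine map. -/
lemma lintegral_stdGauss_affine [DecidableEq ι] {M : Matrix ι ι ℝ} (hM : M.det ≠ 0) (k : ι → ℝ)
    {f : (ι → ℝ) → ℝ≥0∞} (hf : Measurable f) :
    ∫⁻ g, f g ∂(stdGauss ι)
      = ∫⁻ g, ENNReal.ofReal (Real.exp (-privacyLoss M k g)) * f (M *ᵥ g + k) ∂(stdGauss ι) := by
  have hmeas : Measurable fun g : ι → ℝ => M *ᵥ g := measurable_mulVec M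
  have haff : Measurable fun g : ι → ℝ => M *ᵥ g + k := hmeas.add_const k
  have hvol : (volume : Measure (ι → ℝ))
      = ENNReal.ofReal |M.det| • Measure.map (fun g => M *ᵥ g) volume := by
    have := Real.map_matrix_volume_pi_eq_smul_volume_pi hM
    have h2 : Measure.map (fun g => M *ᵥ g) (volume : Measure (ι → ℝ))
        = ENNReal.ofReal |M.det⁻¹| • volume := this
    rw [h2, smul_smul, ← ENNReal.ofReal_mul (abs_nonneg _), ← abs_mul, mul_inv_cancel₀ hM]
    simp
  have hF : Measurable fun g : ι → ℝ => ENNReal.ofReal (stdDensity g) * f g :=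
    measurable_stdDensity.ennreal_ofReal.mul hf
  have hFk : Measurable fun g : ι → ℝ => ENNReal.ofReal (stdDensity (g + k)) * f (g + k) :=
    hF.comp (measurable_add_const k)
  have hFaff : Measurable fun g : ι → ℝ =>
      ENNReal.ofReal (stdDensity (M *ᵥ g + k)) * f (M *ᵥ g + k) := hF.comp haff
  have hR : Measurable fun g : ι → ℝ =>
      ENNReal.ofReal (Real.exp (-privacyLoss M k g)) * f (M *ᵥ g + k) :=
    (measurable_privacyLoss M k).neg.exp.ennreal_ofReal.mul (hf.comp haff)
  rw [lintegral_stdGauss hf, lintegral_stdGauss hR,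
    ← lintegral_add_right_eq_self (μ := (volume : Measure (ι → ℝ))) _ k]
  conv_lhs => rw [hvol]
  rw [lintegral_smul_measure, lintegral_map hFk hmeas,
    smul_eq_mul, ← lintegral_const_mul _ hFaff]
  refine lintegral_congr fun g => ?_
  rw [← mul_assoc, ← mul_assoc, ← ENNReal.ofReal_mul (abs_nonneg _),
    ← ENNReal.ofReal_mul (stdDensity_pos g).le, det_mul_stdDensity hM]

lemma mulVec_dotProduct_mulVec (M : Matrix ι ι ℝ) (g h : ι → ℝ) :
    (M *ᵥ g) ⬝ᵥ (M *ᵥ h) = g ⬝ᵥ ((Mᵀ * M) *ᵥ h) := by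
  rw [← mulVec_mulVec, dotProduct_mulVec g, vecMul_transpose]

/-- The standard Gaussian measure is invariant under orthogonal maps. -/
lemma lintegral_stdGauss_orthogonal [DecidableEq ι] {U : Matrix ι ι ℝ} (hU : Uᵀ * U = 1)
    {f : (ι → ℝ) → ℝ≥0∞} (hf : Measurable f) :
    ∫⁻ g, f g ∂(stdGauss ι) = ∫⁻ g, f (U *ᵥ g) ∂(stdGauss ι) := by
  have hdet : U.det * U.det = 1 := by
    have := congrArg det hU
    rwa [det_mul, det_transpose, det_one] at this
  have h0 : U.det ≠ 0 := fun h => by simp [h] at hdet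
  have habs : |U.det| = 1 := by
    rcases mul_self_eq_one_iff.1 hdet with h | h <;> simp [h]
  rw [lintegral_stdGauss_affine h0 0 hf]
  refine lintegral_congr fun g => ?_
  simp [privacyLoss, habs, mulVec_dotProduct_mulVec, hU]

/-! ### Logarithmic inequalities and exponential moments of Gaussian quadratics -/

lemma neg_log_one_sub_le {a : ℝ} (h : |a| ≤ 1 / 2) : -Real.log (1 - a) ≤ a + a ^ 2 := by
  obtain ⟨h1, h2⟩ := abs_le.1 h
  rcases le_total 0 a with ha | ha
  · rw [neg_le, Real.le_log_iff_exp_le (by linarith), Real.exp_neg,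
      inv_le_comm₀ (Real.exp_pos _) (by linarith)]
    refine le_trans ?_ (Real.quadratic_le_exp_of_nonneg (by positivity))
    rw [inv_le_iff_one_le_mul₀ (by linarith)]
    nlinarith [mul_nonneg ha ha, mul_nonneg ha (mul_nonneg ha ha),
      mul_nonneg (mul_nonneg ha ha) (mul_nonneg ha ha),
      mul_nonneg (mul_nonneg ha ha) (sub_nonneg.2 h2),
      mul_nonneg (mul_nonneg ha (mul_nonneg ha ha)) (sub_nonneg.2 h2),
      mul_nonneg (mul_nonneg (mul_nonneg ha ha) (mul_nonneg ha ha)) (sub_nonneg.2 h2)]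
  · have := Real.le_log_one_add_of_nonneg (x := -a) (by linarith)
    rw [← sub_eq_add_neg] at this
    refine le_trans (neg_le_neg this) ?_
    rw [neg_le, le_div_iff₀ (by linarith)]
    nlinarith [mul_nonneg (neg_nonneg.2 ha) (neg_nonneg.2 ha),
      mul_nonneg (neg_nonneg.2 ha) (mul_nonneg (neg_nonneg.2 ha) (neg_nonneg.2 ha))]

lemma sub_one_sub_log_le {t : ℝ} (h : |t - 1| ≤ 1 / 2) : t - 1 - Real.log t ≤ (t - 1) ^ 2 := by
  have := neg_log_one_sub_le (a := 1 - t) (by rwa [abs_sub_comm])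
  rw [sub_sub_cancel] at this
  linarith [sq_nonneg (t - 1), show (1 - t) ^ 2 = (t - 1) ^ 2 by ring]

/-- Exponential moments of a quadratic polynomial in one Gaussian variable. -/
lemma lintegral_exp_quadratic_gaussianReal_le {a b : ℝ} (ha : |a| ≤ 1 / 2) :
    ∫⁻ x, ENNReal.ofReal (Real.exp (a * x ^ 2 / 2 + b * x)) ∂(gaussianReal 0 1)
      ≤ ENNReal.ofReal (Real.exp (a / 2 + a ^ 2 / 2 + b ^ 2)) := by
  obtain ⟨h1, h2⟩ := abs_le.1 ha
  have hpos : 0 < 1 - a := by linarith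
  have hv : (⟨(1 - a)⁻¹, by positivity⟩ : NNReal) ≠ 0 := by
    intro h
    exact (inv_pos.2 hpos).ne' (congrArg NNReal.toReal h)
  set v : NNReal := ⟨(1 - a)⁻¹, by positivity⟩ with hvdef
  have hvc : (v : ℝ) = (1 - a)⁻¹ := rfl
  -- Completing the square: the tilted density is a constant times the density of N(b/(1 - a), 1/(1
  -- - a)).
  have hpt : ∀ x, gaussianPDF 0 1 x * ENNReal.ofReal (Real.exp (a * x ^ 2 / 2 + b * x))
      = ENNReal.ofReal (Real.exp (-Real.log (1 - a) / 2 + b ^ 2 / (2 * (1 - a))))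
        * gaussianPDF (b / (1 - a)) v x := by
    intro x
    unfold gaussianPDF
    rw [← ENNReal.ofReal_mul (gaussianPDFReal_nonneg _ _ _),
      ← ENNReal.ofReal_mul (Real.exp_pos _).le]
    congr 1
    unfold gaussianPDFReal
    rw [hvc]
    have hsq : (√(2 * Real.pi * (1 - a)⁻¹))⁻¹
        = (√(2 * Real.pi))⁻¹ * Real.exp (Real.log (1 - a) / 2) := by
      rw [Real.sqrt_mul (by positivity), mul_inv, Real.sqrt_inv, inv_inv]
      congr 1
      rw [Real.sqrt_eq_rpow, Real.rpow_def_of_pos hpos]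
      ring_nf
    rw [hsq, NNReal.coe_one, mul_one, mul_assoc, mul_assoc, ← Real.exp_add, ← Real.exp_add,
      mul_left_comm, ← Real.exp_add]
    congr 2
    field_simp
    ring
  rw [gaussianReal_of_var_ne_zero 0 one_ne_zero,
    lintegral_withDensity_eq_lintegral_mul _ (measurable_gaussianPDF 0 1) (by fun_prop)]
  simp only [Pi.mul_apply]
  simp_rw [hpt]
  rw [lintegral_const_mul _ (measurable_gaussianPDF _ _), lintegral_gaussianPDF_eq_one _ hv,
    mul_one]
  refine ENNReal.ofReal_le_ofReal (Real.exp_le_exp.2 ?_)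
  have hb : b ^ 2 / (2 * (1 - a)) ≤ b ^ 2 :=
    div_le_self (sq_nonneg b) (by linarith)
  linarith [neg_log_one_sub_le ha]

lemma lintegral_exp_quadratic_stdGauss_le {a b : ι → ℝ} (ha : ∀ i, |a i| ≤ 1 / 2) :
    ∫⁻ g, ENNReal.ofReal (Real.exp (∑ i, (a i * g i ^ 2 / 2 + b i * g i))) ∂(stdGauss ι)
      ≤ ENNReal.ofReal (Real.exp (∑ i, (a i / 2 + a i ^ 2 / 2 + b i ^ 2))) := by
  set X : ι → ℝ → ℝ≥0∞ := fun i x => ENNReal.ofReal (Real.exp (a i * x ^ 2 / 2 + b i * x))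
    with hX
  have hXm : ∀ i, Measurable (X i) := fun i => by simp only [hX]; fun_prop
  have hind : iIndepFun (fun i (g : ι → ℝ) => X i (g i)) (stdGauss ι) :=
    iIndepFun_pi fun i => (hXm i).aemeasurable
  have h := lintegral_prod_eq_prod_lintegral_of_indepFun Finset.univ _ hind
    fun i => (hXm i).comp (measurable_pi_apply i)
  simp_rw [Real.exp_sum, ENNReal.ofReal_prod_of_nonneg fun i _ => (Real.exp_pos _).le]
  refine h.trans_le (Finset.prod_le_prod' fun i _ => ?_)
  refine le_trans (le_of_eq ?_) (lintegral_exp_quadratic_gaussianReal_le (b := b i) (ha i))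
  exact (measurePreserving_eval (fun _ : ι => gaussianReal 0 1) i).lintegral_comp (hXm i)

end Gaussian

end CovMask

namespace CovMask

/-! ### Tail of the privacy loss -/

section Tail

variable {ι : Type*} [Fintype ι] [DecidableEq ι]

lemma exists_orthogonal_diagonalization {M : Matrix ι ι ℝ} {γ : ℝ}
    (hM : ∀ (t : ℝ) (v : ι → ℝ), v ≠ 0 → (Mᵀ * M) *ᵥ v = t • v → |t - 1| ≤ γ) :
    ∃ (U : Matrix ι ι ℝ) (D : ι → ℝ), Uᵀ * U = 1 ∧ (M * U)ᵀ * (M * U) = diagonal D ∧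
      ∀ i, |D i - 1| ≤ γ := by
  have hA : (Mᵀ * M).IsHermitian := by
    have := isHermitian_conjTranspose_mul_self M
    rwa [conjTranspose_eq_transpose_of_trivial] at this
  refine ⟨hA.eigenvectorUnitary, hA.eigenvalues, ?_, ?_, fun i => ?_⟩
  · have := Unitary.coe_star_mul_self hA.eigenvectorUnitary
    rwa [star_eq_conjTranspose, conjTranspose_eq_transpose_of_trivial] at this
  · have := hA.conjStarAlgAut_star_eigenvectorUnitary
    rw [Unitary.conjStarAlgAut_apply, Unitary.coe_star, star_star, star_eq_conjTranspose,
      conjTranspose_eq_transpose_of_trivial] at this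
    rw [transpose_mul, Matrix.mul_assoc, ← Matrix.mul_assoc Mᵀ, ← Matrix.mul_assoc, this]
    rfl
  · refine hM _ _ ?_ (hA.mulVec_eigenvectorBasis i)
    intro h
    have h1 := hA.eigenvectorBasis.orthonormal.ne_zero i
    exact h1 (by ext j; exact congrFun h j)

lemma prod_eq_det_sq {M U : Matrix ι ι ℝ} {D : ι → ℝ} (hU : Uᵀ * U = 1)
    (hD : (M * U)ᵀ * (M * U) = diagonal D) : ∏ i, D i = M.det ^ 2 := by
  have h1 := congrArg det hU
  have h2 := congrArg det hD
  simp only [det_mul, det_transpose, det_one, det_diagonal] at h1 h2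
  rw [← h2]
  linear_combination M.det ^ 2 * h1

lemma sum_log_eq {M U : Matrix ι ι ℝ} {D : ι → ℝ} {γ : ℝ} (hU : Uᵀ * U = 1)
    (hD : (M * U)ᵀ * (M * U) = diagonal D) (hγ : γ ≤ 1 / 2) (hDγ : ∀ i, |D i - 1| ≤ γ) :
    ∑ i, Real.log (D i) = 2 * Real.log |M.det| := by
  rw [← Real.log_prod fun i _ => ?_, prod_eq_det_sq hU hD, Real.log_abs, Real.log_pow]
  · norm_num
  · have := (abs_le.1 (hDγ i)).1
    linarith

/-- The eigenbasis of MᵀM decouples the coordinates, while the rotation leaves g ⬝ᵥ g unchanged. -/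
lemma privacyLoss_rotate {M U : Matrix ι ι ℝ} {D : ι → ℝ} {γ : ℝ} (hU : Uᵀ * U = 1)
    (hD : (M * U)ᵀ * (M * U) = diagonal D) (hγ : γ ≤ 1 / 2) (hDγ : ∀ i, |D i - 1| ≤ γ)
    (k g : ι → ℝ) :
    privacyLoss M k (U *ᵥ g) = -(∑ i, Real.log (D i)) / 2 + k ⬝ᵥ k / 2
      + ∑ i, ((D i - 1) * g i ^ 2 / 2 + ((M * U)ᵀ *ᵥ k) i * g i) := by
  have h1 : (U *ᵥ g) ⬝ᵥ (U *ᵥ g) = g ⬝ᵥ g := by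
    rw [mulVec_dotProduct_mulVec, hU, one_mulVec]
  have h2 : ((M * U) *ᵥ g) ⬝ᵥ ((M * U) *ᵥ g) = ∑ i, D i * g i ^ 2 := by
    rw [mulVec_dotProduct_mulVec, hD]
    simp only [dotProduct, mulVec_diagonal]
    exact Finset.sum_congr rfl fun i _ => by ring
  have h3 : ((M * U) *ᵥ g) ⬝ᵥ k = ∑ i, ((M * U)ᵀ *ᵥ k) i * g i := by
    rw [dotProduct_comm, dotProduct_mulVec, ← mulVec_transpose]
    rfl
  have h4 : g ⬝ᵥ g = ∑ i, g i ^ 2 := Finset.sum_congr rfl fun i _ => by ring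
  rw [privacyLoss, mulVec_mulVec, h1, add_dotProduct, dotProduct_add, dotProduct_add, h2,
    dotProduct_comm k, h3, h4, sum_log_eq hU hD hγ hDγ, Finset.sum_add_distrib]
  have h5 : ∑ i, (D i - 1) * g i ^ 2 / 2 = (∑ i, D i * g i ^ 2 - ∑ i, g i ^ 2) / 2 := by
    rw [← Finset.sum_sub_distrib, Finset.sum_div]
    exact Finset.sum_congr rfl fun i _ => by ring
  rw [h5]
  ring

/-- W and Wᵀ have the same operator norm, and ‖W‖² ≤ 1 + γ ≤ 3/2. With b = Wᵀk, Cauchy–Schwarz on b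
⬝ᵥ b = k ⬝ᵥ Wb transfers the bound from W to Wᵀ. -/
lemma dotProduct_transpose_mulVec_le {W : Matrix ι ι ℝ} {D : ι → ℝ} {γ : ℝ}
    (hD : Wᵀ * W = diagonal D) (hγ : γ ≤ 1 / 2) (hDγ : ∀ i, |D i - 1| ≤ γ) (k : ι → ℝ) :
    (Wᵀ *ᵥ k) ⬝ᵥ (Wᵀ *ᵥ k) ≤ 3 / 2 * (k ⬝ᵥ k) := by
  set b := Wᵀ *ᵥ k with hb
  have h1 : b ⬝ᵥ b = k ⬝ᵥ (W *ᵥ b) := by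
    rw [dotProduct_mulVec k, ← mulVec_transpose W k]
  have h2 : (W *ᵥ b) ⬝ᵥ (W *ᵥ b) ≤ 3 / 2 * (b ⬝ᵥ b) := by
    rw [mulVec_dotProduct_mulVec, hD]
    simp only [dotProduct, mulVec_diagonal]
    rw [Finset.mul_sum]
    refine Finset.sum_le_sum fun i _ => ?_
    have := (abs_le.1 (hDγ i)).2
    nlinarith [mul_self_nonneg (b i)]
  have h3 : (k ⬝ᵥ (W *ᵥ b)) ^ 2 ≤ (k ⬝ᵥ k) * ((W *ᵥ b) ⬝ᵥ (W *ᵥ b)) := by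
    have := Finset.sum_mul_sq_le_sq_mul_sq Finset.univ k (W *ᵥ b)
    simpa only [dotProduct, sq] using this
  have hk : 0 ≤ k ⬝ᵥ k := Finset.sum_nonneg fun i _ => mul_self_nonneg _
  have hbb : 0 ≤ b ⬝ᵥ b := Finset.sum_nonneg fun i _ => mul_self_nonneg _
  rw [← h1] at h3
  rcases hbb.eq_or_lt with h0 | h0
  · rw [← h0]; positivity
  · have h4 : (b ⬝ᵥ b) * (b ⬝ᵥ b) ≤ (3 / 2 * (k ⬝ᵥ k)) * (b ⬝ᵥ b) := by
      nlinarith [mul_le_mul_of_nonneg_left h2 hk]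
    exact le_of_mul_le_mul_right h4 h0

/-- Exponential moments of the privacy loss. -/
lemma lintegral_exp_privacyLoss_le {M : Matrix ι ι ℝ} {γ : ℝ} (hγ : γ ≤ 1 / 2)
    (hM : ∀ (t : ℝ) (v : ι → ℝ), v ≠ 0 → (Mᵀ * M) *ᵥ v = t • v → |t - 1| ≤ γ) (k : ι → ℝ)
    {l : ℝ} (hl : 0 ≤ l) (hlγ : l * γ ≤ 1 / 2) :
    ∫⁻ g, ENNReal.ofReal (Real.exp (l * privacyLoss M k g)) ∂(stdGauss ι)
      ≤ ENNReal.ofReal (Real.exp (l * (Fintype.card ι * γ ^ 2 / 2 + k ⬝ᵥ k / 2)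
          + l ^ 2 * (Fintype.card ι * γ ^ 2 / 2 + 3 / 2 * (k ⬝ᵥ k)))) := by
  obtain ⟨U, D, hU, hD, hDγ⟩ := exists_orthogonal_diagonalization hM
  set b := (M * U)ᵀ *ᵥ k with hb
  set c := -(∑ i, Real.log (D i)) / 2 + k ⬝ᵥ k / 2 with hc
  rw [lintegral_stdGauss_orthogonal hU
    ((measurable_privacyLoss M k).const_mul l).exp.ennreal_ofReal]
  have hpt : ∀ g : ι → ℝ, ENNReal.ofReal (Real.exp (l * privacyLoss M k (U *ᵥ g)))
      = ENNReal.ofReal (Real.exp (l * c)) * ENNReal.ofReal (Real.exp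
        (∑ i, ((l * (D i - 1)) * g i ^ 2 / 2 + (l * b i) * g i))) := by
    intro g
    rw [privacyLoss_rotate hU hD hγ hDγ, ← ENNReal.ofReal_mul (Real.exp_pos _).le,
      ← Real.exp_add, mul_add, Finset.mul_sum]
    congr 3
    exact Finset.sum_congr rfl fun i _ => by ring
  simp_rw [hpt]
  rw [lintegral_const_mul _ (by fun_prop)]
  have ha : ∀ i, |l * (D i - 1)| ≤ 1 / 2 := fun i => by
    rw [abs_mul, abs_of_nonneg hl]
    exact (mul_le_mul_of_nonneg_left (hDγ i) hl).trans hlγ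
  refine (mul_le_mul_right (lintegral_exp_quadratic_stdGauss_le ha) _).trans ?_
  rw [← ENNReal.ofReal_mul (Real.exp_pos _).le, ← Real.exp_add]
  refine ENNReal.ofReal_le_ofReal (Real.exp_le_exp.2 ?_)
  have hbb : ∑ i, b i ^ 2 ≤ 3 / 2 * (k ⬝ᵥ k) := by
    have := dotProduct_transpose_mulVec_le hD hγ hDγ k
    simpa only [dotProduct, sq] using this
  have hsq : ∀ i, (D i - 1) ^ 2 ≤ γ ^ 2 := fun i => by
    rw [← sq_abs]
    exact pow_le_pow_left₀ (abs_nonneg _) (hDγ i) 2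
  have hS2 : ∑ i, (D i - 1) ^ 2 ≤ Fintype.card ι * γ ^ 2 := by
    refine (Finset.sum_le_sum fun i _ => hsq i).trans (le_of_eq ?_)
    simp
  -- The linear term of the moments meets the log-determinant here: only a second-order quantity in
  -- γ survives.
  have hS1 : ∑ i, (D i - 1) - ∑ i, Real.log (D i) ≤ Fintype.card ι * γ ^ 2 := by
    rw [← Finset.sum_sub_distrib]
    exact (Finset.sum_le_sum fun i _ => sub_one_sub_log_le ((hDγ i).trans hγ)).trans hS2
  have hsum : ∑ i, (l * (D i - 1) / 2 + (l * (D i - 1)) ^ 2 / 2 + (l * b i) ^ 2)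
      = l * (∑ i, (D i - 1)) / 2 + l ^ 2 * (∑ i, (D i - 1) ^ 2) / 2 + l ^ 2 * ∑ i, b i ^ 2 := by
    simp only [Finset.mul_sum, Finset.sum_div, ← Finset.sum_add_distrib]
    exact Finset.sum_congr rfl fun i _ => by ring
  rw [hsum, hc]
  nlinarith [mul_le_mul_of_nonneg_left hS1 hl, mul_le_mul_of_nonneg_left hS2 (sq_nonneg l),
    mul_le_mul_of_nonneg_left hbb (sq_nonneg l)]

/-- Tail bound for the privacy loss. -/
lemma measure_privacyLoss_gt_le {M : Matrix ι ι ℝ} {γ : ℝ} (hγ0 : 0 < γ) (hγ : γ ≤ 1 / 2)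
    (hM : ∀ (t : ℝ) (v : ι → ℝ), v ≠ 0 → (Mᵀ * M) *ᵥ v = t • v → |t - 1| ≤ γ) (k : ι → ℝ)
    {x v ε : ℝ} (hx : 0 ≤ x) (hv : 0 < v)
    (hkv : Fintype.card ι * γ ^ 2 / 2 + 3 / 2 * (k ⬝ᵥ k) ≤ v)
    (hε : Fintype.card ι * γ ^ 2 / 2 + k ⬝ᵥ k / 2 + 2 * √(x * v) + 2 * γ * x ≤ ε) :
    stdGauss ι {g | ε < privacyLoss M k g} ≤ ENNReal.ofReal (Real.exp (-x)) := by
  -- Chernoff parameter: l = √(x/v) balances the two terms when the moment bound allows it;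
  -- otherwise the largest admissible l = 1/(2γ) is taken, and the term 2γx pays for it.
  obtain ⟨l, hl, hlγ, hlx⟩ : ∃ l : ℝ, 0 ≤ l ∧ l * γ ≤ 1 / 2 ∧
      l ^ 2 * v - l * (2 * √(x * v) + 2 * γ * x) ≤ -x := by
    have hs : √(x * v) ^ 2 = x * v := Real.sq_sqrt (by positivity)
    have hs0 := Real.sqrt_nonneg (x * v)
    rcases le_total (√(x * v) / v * γ) (1 / 2) with h | h
    · refine ⟨√(x * v) / v, by positivity, h, ?_⟩
      have h1 : (√(x * v) / v) ^ 2 * v = x := by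
        rw [div_pow, hs]; field_simp
      have h2 : √(x * v) / v * √(x * v) = x := by
        rw [div_mul_eq_mul_div, ← sq, hs]; field_simp
      have h3 : 0 ≤ √(x * v) / v * (γ * x) := by positivity
      nlinarith
    · refine ⟨1 / (2 * γ), by positivity, le_of_eq (by field_simp), ?_⟩
      have h1 : 1 / (2 * γ) ≤ √(x * v) / v := by
        rw [div_le_iff₀ (by positivity)]
        linarith
      have h2 : 1 / (2 * γ) * v ≤ √(x * v) := by rwa [le_div_iff₀ hv] at h1
      have h3 : 0 ≤ 1 / (2 * γ) := by positivity
      have h4 : 1 / (2 * γ) * (2 * γ * x) = x := by field_simp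
      have h5 := mul_le_mul_of_nonneg_left h2 h3
      have h6 := mul_nonneg h3 hs0
      nlinarith
  have hLm := measurable_privacyLoss M k
  have hsub : {g | ε < privacyLoss M k g}
      ⊆ {g | 1 ≤ ENNReal.ofReal (Real.exp (-(l * ε)))
          * ENNReal.ofReal (Real.exp (l * privacyLoss M k g))} := by
    intro g hg
    rw [Set.mem_ofPred_eq] at hg ⊢
    rw [← ENNReal.ofReal_mul (Real.exp_pos _).le, ← Real.exp_add, ENNReal.one_le_ofReal,
      Real.one_le_exp_iff]
    nlinarith [mul_le_mul_of_nonneg_left hg.le hl]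
  have hmark := mul_meas_ge_le_lintegral (μ := stdGauss ι)
    ((hLm.const_mul l).exp.ennreal_ofReal.const_mul
      (ENNReal.ofReal (Real.exp (-(l * ε))))) 1
  rw [one_mul, lintegral_const_mul _ (hLm.const_mul l).exp.ennreal_ofReal] at hmark
  refine (measure_mono hsub).trans (hmark.trans ((mul_le_mul_right
    (lintegral_exp_privacyLoss_le hγ hM k hl hlγ) _).trans ?_))
  rw [← ENNReal.ofReal_mul (Real.exp_pos _).le, ← Real.exp_add]
  refine ENNReal.ofReal_le_ofReal (Real.exp_le_exp.2 ?_)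
  nlinarith [mul_le_mul_of_nonneg_left hkv (sq_nonneg l), mul_le_mul_of_nonneg_left hε hl]

/-- A tail bound for the privacy loss gives one half of indistinguishability. -/
lemma stdGauss_preimage_le {Z : Type*} [MeasurableSpace Z] {M : Matrix ι ι ℝ} (hM : M.det ≠ 0)
    (k : ι → ℝ) {F : (ι → ℝ) → Z} (hF : Measurable F) {ε : ℝ} {S : Set Z}
    (hS : MeasurableSet S) :
    stdGauss ι ((fun g => F (M *ᵥ g + k)) ⁻¹' S)
      ≤ ENNReal.ofReal (Real.exp ε) * stdGauss ι (F ⁻¹' S)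
        + stdGauss ι {g | ε < privacyLoss M k g} := by
  have hLm := measurable_privacyLoss M k
  set T := (fun g => F (M *ᵥ g + k)) ⁻¹' S with hT
  have hTm : MeasurableSet T := (hF.comp ((measurable_mulVec M).add_const k)) hS
  have hE : MeasurableSet {g | ε < privacyLoss M k g} := measurableSet_lt measurable_const hLm
  -- The probability of F ∈ S becomes the integral of exp(-loss) over T; where the loss is at most
  -- ε, the weight e^ε · exp(-loss) is at least 1.
  have h1 := lintegral_stdGauss_affine hM k
    (measurable_one.indicator (hF hS) : Measurable ((F ⁻¹' S).indicator (1 : (ι → ℝ) → ℝ≥0∞)))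
  rw [lintegral_indicator_one (hF hS)] at h1
  rw [h1, ← lintegral_const_mul _ (by
    exact hLm.neg.exp.ennreal_ofReal.mul
      ((measurable_one.indicator (hF hS)).comp ((measurable_mulVec M).add_const k))),
    ← lintegral_indicator_one hTm, ← lintegral_indicator_one hE,
    ← lintegral_add_right _ (measurable_one.indicator hE)]
  refine lintegral_mono fun g => ?_
  by_cases hgT : g ∈ T
  · have hgS : M *ᵥ g + k ∈ F ⁻¹' S := hgT
    simp only [Set.indicator_of_mem hgT, Set.indicator_of_mem hgS, Pi.one_apply, mul_one]
    by_cases hgE : ε < privacyLoss M k g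
    · rw [Set.indicator_of_mem (by exact hgE)]
      exact le_add_self
    · refine le_add_right ?_
      rw [← ENNReal.ofReal_mul (Real.exp_pos _).le, ← Real.exp_add, ENNReal.one_le_ofReal,
        Real.one_le_exp_iff]
      linarith
  · rw [Set.indicator_of_notMem hgT]
    exact zero_le

end Tail

end CovMask

namespace CovMask

/-! ### Spectral and Frobenius bounds for B⁻¹A -/

section Matrices

variable {d : ℕ}

lemma posDef_sqrt {A : Matrix (Fin d) (Fin d) ℝ} (hA : A.PosDef) : (CFC.sqrt A).PosDef := by
  have h := CFC.sqrt_mul_sqrt_self A hA.posSemidef.nonneg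
  refine (CFC.sqrt_nonneg A).posSemidef.posDef_iff_det_ne_zero.2 fun h0 => ?_
  have h1 := congrArg det h
  rw [det_mul, h0, zero_mul] at h1
  exact hA.det_pos.ne h1

lemma sqrt_mul_sqrt {A : Matrix (Fin d) (Fin d) ℝ} (hA : A.PosDef) :
    CFC.sqrt A * CFC.sqrt A = A :=
  CFC.sqrt_mul_sqrt_self A hA.posSemidef.nonneg

lemma transpose_eq_of_posDef {A : Matrix (Fin d) (Fin d) ℝ} (hA : A.PosDef) : Aᵀ = A := by
  have := hA.isHermitian.eq
  rwa [conjTranspose_eq_transpose_of_trivial] at this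

lemma transpose_inv_of_posDef {A : Matrix (Fin d) (Fin d) ℝ} (hA : A.PosDef) : A⁻¹ᵀ = A⁻¹ := by
  rw [transpose_nonsing_inv, transpose_eq_of_posDef hA]

/-- Sum of log λ ≤ λ - 1 over the eigenvalues. -/
lemma card_add_log_det_le_trace {Q : Matrix (Fin d) (Fin d) ℝ} (hQ : Q.PosDef) :
    d + Real.log Q.det ≤ Q.trace := by
  have h1 := hQ.isHermitian.det_eq_prod_eigenvalues
  have h2 := hQ.isHermitian.trace_eq_sum_eigenvalues
  simp only [RCLike.ofReal_real_eq_id, id] at h1 h2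
  rw [h1, h2, Real.log_prod fun i _ => (hQ.eigenvalues_pos i).ne']
  have h3 : ∑ i, (1 + Real.log (hQ.isHermitian.eigenvalues i))
      ≤ ∑ i, hQ.isHermitian.eigenvalues i :=
    Finset.sum_le_sum fun i _ => by linarith [Real.log_le_sub_one_of_pos (hQ.eigenvalues_pos i)]
  rw [Finset.sum_add_distrib] at h3
  simpa using h3

/-- B⁻¹A need not be symmetric, but it has the trace and determinant of the positive definite matrix
B^{-1/2} A B^{-1/2}. -/
lemma card_add_log_det_inv_mul_le_trace {A B : Matrix (Fin d) (Fin d) ℝ} (hA : A.PosDef)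
    (hB : B.PosDef) : d + Real.log (B⁻¹ * A).det ≤ (B⁻¹ * A).trace := by
  have hS := posDef_sqrt hB
  have hSB : (CFC.sqrt B)⁻¹ * (CFC.sqrt B)⁻¹ = B⁻¹ := by
    rw [← Matrix.mul_inv_rev, sqrt_mul_sqrt hB]
  have hQ : ((CFC.sqrt B)⁻¹ * A * (CFC.sqrt B)⁻¹).PosDef := by
    have := hA.conjTranspose_mul_mul_same (B := (CFC.sqrt B)⁻¹)
      (mulVec_injective_of_isUnit ((isUnit_nonsing_inv_iff).2 hS.isUnit))
    rwa [conjTranspose_eq_transpose_of_trivial, transpose_inv_of_posDef hS] at this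
  have h := card_add_log_det_le_trace hQ
  rwa [trace_mul_cycle, hSB, det_mul, det_mul, mul_right_comm, ← det_mul, hSB, ← det_mul] at h

/-- If PᵀPW = tW, then PW is a nonzero solution of PPᵀ(PW) = t(PW), so |t - 1| is bounded by the
norm of PPᵀ - I. Allowing matrices W covers both eigenvectors of PᵀP (one column) and those of its
Kronecker product with I. -/
lemma abs_sub_one_le_of_mul_eq_smul {n : Type*} [Fintype n] [DecidableEq n]
    {P : Matrix (Fin d) (Fin d) ℝ} {γ t : ℝ} (hP : P.det ≠ 0) (hγ : ‖P * Pᵀ - 1‖ ≤ γ)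
    {W : Matrix (Fin d) n ℝ} (hW : W ≠ 0) (h : Pᵀ * (P * W) = t • W) : |t - 1| ≤ γ := by
  have hPW : P * W ≠ 0 := fun h0 => hW (by
    rw [← Matrix.one_mul W, ← nonsing_inv_mul P hP.isUnit, Matrix.mul_assoc, h0, Matrix.mul_zero])
  have h1 : (P * Pᵀ - 1) * (P * W) = (t - 1) • (P * W) := by
    rw [Matrix.sub_mul, Matrix.mul_assoc, h, Matrix.mul_smul, Matrix.one_mul, sub_smul, one_smul]
  have h2 := l2_opNorm_mul (P * Pᵀ - 1) (P * W)
  rw [h1, norm_smul, Real.norm_eq_abs] at h2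
  exact (le_of_mul_le_mul_right h2 (norm_pos_iff.2 hPW)).trans hγ

/-- Relative perturbation bound for square roots in Frobenius norm. -/
lemma sum_sq_inv_mul_sub_one_le {A B : Matrix (Fin d) (Fin d) ℝ} (hA : A.PosDef)
    (hB : B.PosDef) {γ : ℝ} (hγ : γ ≤ 1 / 2) (h : ‖B⁻¹ * A * (B⁻¹ * A)ᵀ - 1‖ ≤ γ) :
    ∑ i, ∑ j, (B⁻¹ * A - 1) i j ^ 2 ≤ d * γ ^ 2 := by
  set P := B⁻¹ * A with hPdef
  have hPdet : 0 < P.det := by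
    rw [hPdef, det_mul]
    exact mul_pos hB.inv.det_pos hA.det_pos
  have hP : ∀ (t : ℝ) (v : Fin d → ℝ), v ≠ 0 → (Pᵀ * P) *ᵥ v = t • v → |t - 1| ≤ γ := by
    intro t v hv htv
    refine abs_sub_one_le_of_mul_eq_smul (W := replicateCol Unit v) hPdet.ne' h ?_ ?_
    · intro h0
      exact hv (funext fun i => congrFun (congrFun h0 i) ())
    · rw [← Matrix.mul_assoc, ← replicateCol_mulVec, htv, replicateCol_smul]
  obtain ⟨U, D, hU, hD, hDγ⟩ := exists_orthogonal_diagonalization hP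
  have htr : (Pᵀ * P).trace = ∑ i, D i := by
    rw [← trace_diagonal, ← hD, transpose_mul P U, Matrix.mul_assoc Uᵀ, trace_mul_comm Uᵀ,
      Matrix.mul_assoc, Matrix.mul_assoc, mul_eq_one_comm.1 hU, Matrix.mul_one]
  -- Since tr P ≥ d + log det P and 2 log det P = ∑ log D, this expression is at most ∑ (D - 1 - log
  -- D), which is second order in γ.
  have hfro : ∑ i, ∑ j, (P - 1) i j ^ 2 = (Pᵀ * P).trace - 2 * P.trace + d := by
    have h1 : ∑ i, ∑ j, (P - 1) i j ^ 2 = ((P - 1)ᵀ * (P - 1)).trace := by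
      rw [Finset.sum_comm]
      simp only [trace, diag_apply, mul_apply, transpose_apply, sq]
    rw [h1, transpose_sub, transpose_one, Matrix.sub_mul, Matrix.mul_sub, Matrix.mul_sub]
    simp only [Matrix.mul_one, Matrix.one_mul, trace_sub, trace_transpose, trace_one,
      Fintype.card_fin]
    ring
  have hlog := sum_log_eq hU hD hγ hDγ
  rw [abs_of_pos hPdet] at hlog
  have htrace := card_add_log_det_inv_mul_le_trace hA hB
  rw [← hPdef] at htrace
  have hsum : ∑ i, (D i - 1 - Real.log (D i)) ≤ d * γ ^ 2 := by
    refine (Finset.sum_le_sum fun i _ => (sub_one_sub_log_le ((hDγ i).trans hγ)).trans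
      (?_ : _ ≤ γ ^ 2)).trans (le_of_eq (by simp))
    rw [← sq_abs]
    exact pow_le_pow_left₀ (abs_nonneg _) (hDγ i) 2
  rw [Finset.sum_sub_distrib, Finset.sum_sub_distrib] at hsum
  simp only [Finset.sum_const, Finset.card_univ, Fintype.card_fin, nsmul_eq_mul, mul_one] at hsum
  rw [hfro, htr]
  linarith

/-! ### Transfer from Gaussian vectors to the noisy factor -/

/-- The matrix with the given family of entries. -/
def ofEntries (g : Fin d × Fin d → ℝ) : Matrix (Fin d) (Fin d) ℝ := Matrix.of fun i j => g (i, j)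

lemma measurable_of_entries {α : Type*} [MeasurableSpace α] {f : α → Matrix (Fin d) (Fin d) ℝ}
    (hf : ∀ i j, Measurable fun a => f a i j) : Measurable f :=
  measurable_pi_lambda _ fun i => measurable_pi_lambda _ fun j => hf i j

lemma measurable_entry (i j : Fin d) : Measurable fun W : Matrix (Fin d) (Fin d) ℝ => W i j :=
  (measurable_pi_apply j).comp (measurable_pi_apply i)

lemma measurable_mul {α : Type*} [MeasurableSpace α] {f h : α → Matrix (Fin d) (Fin d) ℝ}
    (hf : Measurable f) (hh : Measurable h) : Measurable fun a => f a * h a := by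
  refine measurable_of_entries fun i j => ?_
  simp only [mul_apply]
  exact Finset.measurable_sum _ fun l _ =>
    ((measurable_entry i l).comp hf).mul ((measurable_entry l j).comp hh)

lemma measurable_transpose {α : Type*} [MeasurableSpace α] {f : α → Matrix (Fin d) (Fin d) ℝ}
    (hf : Measurable f) : Measurable fun a => (f a)ᵀ :=
  measurable_of_entries fun i j => (measurable_entry j i).comp hf

lemma measurable_ofEntries :
    Measurable (ofEntries : (Fin d × Fin d → ℝ) → Matrix (Fin d) (Fin d) ℝ) :=
  measurable_of_entries fun i j => measurable_pi_apply (i, j)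

lemma measurable_one_add_smul (η : ℝ) :
    Measurable fun G : Matrix (Fin d) (Fin d) ℝ => 1 + η • G :=
  measurable_of_entries fun i j => ((measurable_entry i j).const_mul η).const_add _

lemma measurable_noisy (η : ℝ) (A : Matrix (Fin d) (Fin d) ℝ) :
    Measurable fun G : Matrix (Fin d) (Fin d) ℝ => A * (1 + η • G) :=
  measurable_mul measurable_const (measurable_one_add_smul η)

lemma gaussianMatrix_eq : gaussianMatrix d = (stdGauss (Fin d × Fin d)).map ofEntries := rfl

instance : IsProbabilityMeasure (gaussianMatrix d) :=
  Measure.isProbabilityMeasure_map measurable_ofEntries.aemeasurable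

lemma noisyFactor_eq (η : ℝ) (A : Matrix (Fin d) (Fin d) ℝ) :
    noisyFactor η A
      = (stdGauss (Fin d × Fin d)).map fun g => CFC.sqrt A * (1 + η • ofEntries g) :=
  Measure.map_map (measurable_noisy η _) measurable_ofEntries

instance (η : ℝ) (A : Matrix (Fin d) (Fin d) ℝ) : IsProbabilityMeasure (noisyFactor η A) :=
  Measure.isProbabilityMeasure_map (measurable_noisy η _).aemeasurable

lemma ofEntries_kronecker_mulVec (P : Matrix (Fin d) (Fin d) ℝ) (g : Fin d × Fin d → ℝ) :
    ofEntries (kroneckerMap (· * ·) P (1 : Matrix (Fin d) (Fin d) ℝ) *ᵥ g) = P * ofEntries g := by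
  ext i j
  simp [ofEntries, mulVec, dotProduct, mul_apply, Fintype.sum_prod_type, one_apply]

lemma ofEntries_smul (t : ℝ) (g : Fin d × Fin d → ℝ) : ofEntries (t • g) = t • ofEntries g := rfl

lemma ofEntries_ne_zero {g : Fin d × Fin d → ℝ} (hg : g ≠ 0) : ofEntries g ≠ 0 :=
  fun h => hg (funext fun p => congrFun (congrFun h p.1) p.2)

lemma noisyFactor_le {η : ℝ} (hη : 0 < η) (hd : 1 ≤ d) {A₁ A₂ : Matrix (Fin d) (Fin d) ℝ}
    (h₁ : A₁.PosDef) (h₂ : A₂.PosDef) {γ δ₀ : ℝ} (hγ0 : 0 < γ) (hγ : γ ≤ 1 / 2)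
    (h : ‖(CFC.sqrt A₂)⁻¹ * A₁ * (CFC.sqrt A₂)⁻¹ - 1‖ ≤ γ) (hδ0 : 0 < δ₀) (hδ : δ₀ ≤ 2)
    {S : Set (Matrix (Fin d) (Fin d) ℝ)} (hS : MeasurableSet S) :
    noisyFactor η A₁ S
      ≤ ENNReal.ofReal (Real.exp (epsZero d η γ δ₀)) * noisyFactor η A₂ S
        + ENNReal.ofReal δ₀ := by
  have hA := posDef_sqrt h₁
  have hB := posDef_sqrt h₂
  set A := CFC.sqrt A₁ with hAdef
  set B := CFC.sqrt A₂ with hBdef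
  set P := B⁻¹ * A with hPdef
  have hPdet : P.det ≠ 0 := by
    rw [hPdef, det_mul]
    exact (mul_pos hB.inv.det_pos hA.det_pos).ne'
  have hPP : ‖P * Pᵀ - 1‖ ≤ γ := by
    rw [hPdef, transpose_mul, transpose_inv_of_posDef hB, transpose_eq_of_posDef hA,
      ← Matrix.mul_assoc, Matrix.mul_assoc B⁻¹ A A, sqrt_mul_sqrt h₁]
    exact h
  set M := kroneckerMap (· * ·) P (1 : Matrix (Fin d) (Fin d) ℝ) with hMdef
  have hMdet : M.det ≠ 0 := by
    rw [hMdef, det_kronecker, det_one, one_pow, mul_one]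
    exact pow_ne_zero _ hPdet
  have hMt : Mᵀ = kroneckerMap (· * ·) Pᵀ (1 : Matrix (Fin d) (Fin d) ℝ) := by
    rw [hMdef, ← kroneckerMap_transpose, transpose_one]
  have hM : ∀ (t : ℝ) (v : Fin d × Fin d → ℝ), v ≠ 0 → (Mᵀ * M) *ᵥ v = t • v →
      |t - 1| ≤ γ := by
    intro t v hv htv
    refine abs_sub_one_le_of_mul_eq_smul hPdet hPP (ofEntries_ne_zero hv) ?_
    rw [← ofEntries_smul, ← htv, ← mulVec_mulVec, hMt, ofEntries_kronecker_mulVec,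
      ofEntries_kronecker_mulVec]
  set k : Fin d × Fin d → ℝ := fun p => (P - 1) p.1 p.2 / η with hk
  have hofk : ofEntries k = η⁻¹ • (P - 1) := by
    ext i j
    simp [ofEntries, hk, div_eq_inv_mul]
  have hkk : k ⬝ᵥ k ≤ d * γ ^ 2 / η ^ 2 := by
    have h1 := sum_sq_inv_mul_sub_one_le hA hB hγ hPP
    have h2 : k ⬝ᵥ k = (∑ i, ∑ j, (P - 1) i j ^ 2) / η ^ 2 := by
      rw [← Fintype.sum_prod_type', Finset.sum_div]
      exact Finset.sum_congr rfl fun p _ => by simp only [hk]; ring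
    rw [h2]
    exact div_le_div_of_nonneg_right h1 (by positivity)
  -- The affine map g ↦ Mg + k turns noise around B into noise around A.
  have hBA : ∀ g, B * (1 + η • ofEntries (M *ᵥ g + k)) = A * (1 + η • ofEntries g) := by
    intro g
    have h1 : ofEntries (M *ᵥ g + k) = P * ofEntries g + η⁻¹ • (P - 1) := by
      rw [← hofk, ← ofEntries_kronecker_mulVec]
      rfl
    have h2 : 1 + η • (P * ofEntries g + η⁻¹ • (P - 1)) = P * (1 + η • ofEntries g) := by
      rw [smul_add, smul_smul, mul_inv_cancel₀ hη.ne', one_smul, Matrix.mul_add, Matrix.mul_one,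
        Matrix.mul_smul]
      abel
    rw [h1, h2, ← Matrix.mul_assoc, hPdef, ← Matrix.mul_assoc,
      mul_nonsing_inv B hB.det_pos.ne'.isUnit, Matrix.one_mul]
  have hF : Measurable fun g => B * (1 + η • ofEntries g) :=
    (measurable_noisy η B).comp measurable_ofEntries
  have hF' : Measurable fun g => A * (1 + η • ofEntries g) :=
    (measurable_noisy η A).comp measurable_ofEntries
  have key := stdGauss_preimage_le hMdet k hF (ε := epsZero d η γ δ₀) hS
  simp only [hBA] at key
  rw [noisyFactor_eq, noisyFactor_eq, Measure.map_apply hF' hS, Measure.map_apply hF hS]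
  refine key.trans (add_le_add_right ?_ _)
  have hd0 : (0 : ℝ) < d := by exact_mod_cast hd
  have hx : 0 ≤ Real.log (2 / δ₀) :=
    Real.log_nonneg (by rwa [le_div_iff₀ hδ0, one_mul])
  set x := Real.log (2 / δ₀) with hxdef
  refine (measure_privacyLoss_gt_le (x := x)
    (v := (d * γ) ^ 2 / 2 + 3 / 2 * (d * γ ^ 2 / η ^ 2)) hγ0 hγ hM k hx (by positivity)
    ?_ ?_).trans ?_
  · simp only [Fintype.card_prod, Fintype.card_fin, Nat.cast_mul]
    linarith
  -- With p = dγ and q = γ√d/η, the variance proxy p²/2 + 3q²/2 is at most (p + 3q/2)².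
  · have hs : √(x * ((d * γ) ^ 2 / 2 + 3 / 2 * (d * γ ^ 2 / η ^ 2)))
        ≤ √x * (d * γ + 3 / 2 * (γ * √d / η)) := by
      rw [Real.sqrt_mul hx]
      refine mul_le_mul_of_nonneg_left (Real.sqrt_le_iff.2 ⟨by positivity, ?_⟩)
        (Real.sqrt_nonneg x)
      have h1 : d * γ ^ 2 / η ^ 2 = (γ * √d / η) ^ 2 := by
        rw [div_pow, mul_pow, Real.sq_sqrt hd0.le, mul_comm]
      rw [h1]
      have h2 : 0 ≤ (d * γ) * (γ * √d / η) := by positivity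
      nlinarith [sq_nonneg (d * γ), sq_nonneg (γ * √d / η)]
    simp only [Fintype.card_prod, Fintype.card_fin, Nat.cast_mul]
    have he : epsZero d η γ δ₀ = d * d * γ ^ 2 / 2 + d * γ ^ 2 / η ^ 2 / 2
        + 2 * (√x * (d * γ + 3 / 2 * (γ * √d / η))) + 2 * γ * x := by
      simp only [epsZero, ← hxdef]
      ring
    rw [he]
    linarith
  · refine ENNReal.ofReal_le_ofReal ?_
    rw [hxdef, Real.exp_neg, Real.exp_log (by positivity), inv_div]
    linarith

/-! ### Indistinguishability of the factors and of the mechanism -/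

lemma eq_of_sqrt_inv_mul_eq_one {A B : Matrix (Fin d) (Fin d) ℝ} (hB : B.PosDef)
    (h : (CFC.sqrt B)⁻¹ * A * (CFC.sqrt B)⁻¹ = 1) : A = B := by
  have hu : IsUnit (CFC.sqrt B).det := (posDef_sqrt hB).det_pos.ne'.isUnit
  calc A = CFC.sqrt B * ((CFC.sqrt B)⁻¹ * A * (CFC.sqrt B)⁻¹) * CFC.sqrt B := by
        rw [Matrix.mul_assoc (CFC.sqrt B)⁻¹, mul_nonsing_inv_cancel_left _ _ hu,
          nonsing_inv_mul_cancel_right _ _ hu]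
    _ = B := by rw [h, Matrix.mul_one, sqrt_mul_sqrt hB]

lemma indistinguishable_of_one_le {Z : Type*} [MeasurableSpace Z] (μ ν : Measure Z)
    [IsProbabilityMeasure μ] [IsProbabilityMeasure ν] {ε δ : ℝ} (hδ : 1 ≤ δ) :
    Indistinguishable μ ν ε δ := by
  have h1 : (1 : ℝ≥0∞) ≤ ENNReal.ofReal δ := ENNReal.one_le_ofReal.2 hδ
  exact fun S _ => ⟨(prob_le_one.trans h1).trans le_add_self,
    (prob_le_one.trans h1).trans le_add_self⟩

lemma indistinguishable_self {Z : Type*} [MeasurableSpace Z] (μ : Measure Z) {ε δ : ℝ}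
    (hε : 0 ≤ ε) : Indistinguishable μ μ ε δ := by
  have h1 : (1 : ℝ≥0∞) ≤ ENNReal.ofReal (Real.exp ε) :=
    ENNReal.one_le_ofReal.2 (Real.one_le_exp hε)
  have h2 : ∀ S, μ S ≤ ENNReal.ofReal (Real.exp ε) * μ S + ENNReal.ofReal δ := fun S =>
    le_add_right (le_mul_of_one_le_left zero_le h1)
  exact fun S _ => ⟨h2 S, h2 S⟩

lemma Indistinguishable.map {Z Z' : Type*} [MeasurableSpace Z] [MeasurableSpace Z']
    {μ ν : Measure Z} {ε δ : ℝ} (h : Indistinguishable μ ν ε δ) {f : Z → Z'}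
    (hf : Measurable f) : Indistinguishable (μ.map f) (ν.map f) ε δ := by
  intro S hS
  rw [Measure.map_apply hf hS, Measure.map_apply hf hS]
  exact h _ (hf hS)

lemma Indistinguishable.mono {Z : Type*} [MeasurableSpace Z] {μ ν : Measure Z} {ε ε' δ : ℝ}
    (h : Indistinguishable μ ν ε δ) (hε : ε ≤ ε') : Indistinguishable μ ν ε' δ := by
  have h1 : ENNReal.ofReal (Real.exp ε) ≤ ENNReal.ofReal (Real.exp ε') :=
    ENNReal.ofReal_le_ofReal (Real.exp_le_exp.2 hε)
  exact fun S hS => ⟨(h S hS).1.trans (by gcongr), (h S hS).2.trans (by gcongr)⟩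

lemma noisyFactor_indistinguishable {η : ℝ} (hη : 0 < η) (hd : 1 ≤ d)
    {A₁ A₂ : Matrix (Fin d) (Fin d) ℝ} (h₁ : A₁.PosDef) (h₂ : A₂.PosDef) {γ δ₀ : ℝ}
    (h : specDist A₁ A₂ ≤ γ) (hγ : γ ≤ 1 / 2) (hδ0 : 0 < δ₀) :
    Indistinguishable (noisyFactor η A₁) (noisyFactor η A₂) (epsZero d η γ δ₀) δ₀ := by
  obtain ⟨h12, h21⟩ := max_le_iff.1 h
  rcases le_total 1 δ₀ with hδ | hδ
  · exact indistinguishable_of_one_le _ _ hδ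
  -- The tail bound needs γ > 0; for γ = 0 the two matrices coincide.
  rcases ((norm_nonneg _).trans h12).eq_or_lt with h0 | h0
  · have he : A₁ = A₂ := eq_of_sqrt_inv_mul_eq_one h₂
      (sub_eq_zero.1 (norm_le_zero_iff.1 (h21.trans h0.ge)))
    rw [he]
    exact indistinguishable_self _ (by simp [epsZero, ← h0])
  · exact fun S hS => ⟨noisyFactor_le hη hd h₁ h₂ h0 hγ h21 hδ0 (by linarith) hS,
      noisyFactor_le hη hd h₂ h₁ h0 hγ h12 hδ0 (by linarith) hS⟩

lemma measurable_mul_transpose_self :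
    Measurable fun Z : Matrix (Fin d) (Fin d) ℝ => Z * Zᵀ :=
  measurable_mul measurable_id (measurable_transpose measurable_id)

lemma covMechanism_eq_map {η : ℝ} {A : Matrix (Fin d) (Fin d) ℝ} (hA : A.PosDef) :
    covMechanism η A = (noisyFactor η A).map fun Z => Z * Zᵀ := by
  rw [noisyFactor, Measure.map_map measurable_mul_transpose_self (measurable_noisy η _),
    covMechanism]
  congr 1
  funext G
  simp only [Function.comp_apply, transpose_mul, transpose_eq_of_posDef (posDef_sqrt hA),
    Matrix.mul_assoc]

lemma covMechanism_indistinguishable {η : ℝ} (hη : 0 < η) (hd : 1 ≤ d)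
    {A₁ A₂ : Matrix (Fin d) (Fin d) ℝ} (h₁ : A₁.PosDef) (h₂ : A₂.PosDef) {γ δ₀ : ℝ}
    (h : specDist A₁ A₂ ≤ γ) (hγ : γ ≤ 1 / 2) (hδ0 : 0 < δ₀) :
    Indistinguishable (covMechanism η A₁) (covMechanism η A₂) (epsZero d η γ δ₀) δ₀ := by
  rw [covMechanism_eq_map h₁, covMechanism_eq_map h₂]
  exact (noisyFactor_indistinguishable hη hd h₁ h₂ h hγ hδ0).map
    measurable_mul_transpose_self

end Matrices

end CovMask

namespace CovMask

/-! ### Almost sure positive definiteness and the masking radius -/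

section Masking

variable {d : ℕ}

lemma continuous_det_smul_one_add (η : ℝ) :
    Continuous fun p : (Fin d × Fin d → ℝ) × ℝ =>
      (p.2 • (1 : Matrix (Fin d) (Fin d) ℝ) + η • ofEntries p.1).det := by
  refine Continuous.matrix_det (continuous_matrix fun i j => ?_)
  simp only [Matrix.add_apply, Matrix.smul_apply, ofEntries, of_apply, smul_eq_mul]
  fun_prop

lemma finite_setOf_det_eq_zero (W : Matrix (Fin d) (Fin d) ℝ) :
    {t : ℝ | (t • (1 : Matrix (Fin d) (Fin d) ℝ) + W).det = 0}.Finite := by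
  refine (finite_real_spectrum (A := -W)).subset fun t ht => ?_
  rw [spectrum.mem_iff, Algebra.algebraMap_eq_smul_one, sub_neg_eq_add, isUnit_iff_isUnit_det]
  exact fun h => h.ne_zero ht

/-- For fixed g, det(tI + ηg) vanishes for only finitely many t. By Fubini some t is good for almost
every g, and a translation of g along the identity moves this t to 1. -/
lemma ae_det_one_add_smul_ne_zero {η : ℝ} (hη : η ≠ 0) :
    ∀ᵐ G ∂(gaussianMatrix d), (1 + η • G).det ≠ 0 := by
  have hc := continuous_det_smul_one_add (d := d) η
  have hmeas : MeasurableSet {p : (Fin d × Fin d → ℝ) × ℝ |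
      (p.2 • (1 : Matrix (Fin d) (Fin d) ℝ) + η • ofEntries p.1).det ≠ 0} :=
    (hc.measurable (measurableSet_singleton 0)).compl
  have h1 : ∀ᵐ g : Fin d × Fin d → ℝ, ∀ᵐ t : ℝ,
      (t • (1 : Matrix (Fin d) (Fin d) ℝ) + η • ofEntries g).det ≠ 0 := by
    refine .of_forall fun g => ?_
    rw [ae_iff]
    simp only [not_not]
    exact (finite_setOf_det_eq_zero _).measure_zero _
  obtain ⟨t, ht⟩ := ((Measure.ae_ae_comm hmeas).1 h1).exists
  set e : Fin d × Fin d → ℝ := fun p => ((1 - t) / η) * (1 : Matrix (Fin d) (Fin d) ℝ) p.1 p.2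
    with he
  have h2 : ∀ᵐ g : Fin d × Fin d → ℝ,
      (t • (1 : Matrix (Fin d) (Fin d) ℝ) + η • ofEntries (g + e)).det ≠ 0 :=
    (measurePreserving_add_right volume e).quasiMeasurePreserving.ae ht
  have h3 : ∀ g, t • (1 : Matrix (Fin d) (Fin d) ℝ) + η • ofEntries (g + e)
      = 1 + η • ofEntries g := by
    intro g
    ext i j
    simp only [ofEntries, he, Matrix.add_apply, Matrix.smul_apply, of_apply, smul_eq_mul, Pi.add_apply]
    field_simp
    ring
  simp only [h3] at h2
  have h4 : ∀ᵐ g ∂(stdGauss (Fin d × Fin d)), (1 + η • ofEntries g).det ≠ 0 := by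
    rw [stdGauss_eq_withDensity]
    exact (withDensity_absolutelyContinuous _ _).ae_le h2
  have hm : Measurable fun G : Matrix (Fin d) (Fin d) ℝ => (1 + η • G).det := by
    simp only [det_apply]
    exact Finset.measurable_sum _ fun σ _ => (Finset.measurable_prod _ fun i _ =>
      (measurable_entry _ _).comp (measurable_one_add_smul η)).const_smul _
  rw [gaussianMatrix_eq]
  exact (ae_map_iff measurable_ofEntries.aemeasurable
    (hm (measurableSet_singleton 0)).compl).2 h4

lemma posDef_conj {A W : Matrix (Fin d) (Fin d) ℝ} (hA : A.PosDef) (hW : W.det ≠ 0) :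
    (A * W * Wᵀ * A).PosDef := by
  have hu : IsUnit (A * W)ᵀ := by
    rw [isUnit_iff_isUnit_det, det_transpose, det_mul]
    exact (mul_ne_zero hA.det_pos.ne' hW).isUnit
  have h := PosDef.conjTranspose_mul_self (A * W)ᵀ (mulVec_injective_of_isUnit hu)
  rwa [conjTranspose_eq_transpose_of_trivial, transpose_transpose, transpose_mul,
    transpose_eq_of_posDef hA, ← Matrix.mul_assoc] at h

/-- Positive definite means symmetric and positive semidefinite (closed conditions) with nonzero
determinant (an open one). -/
lemma measurableSet_posDef : MeasurableSet {A : Matrix (Fin d) (Fin d) ℝ | A.PosDef} := by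
  have hB : BorelSpace (Matrix (Fin d) (Fin d) ℝ) :=
    inferInstanceAs (BorelSpace (Fin d → Fin d → ℝ))
  have hsymm : IsClosed {A : Matrix (Fin d) (Fin d) ℝ | A.IsHermitian} :=
    isClosed_eq continuous_id.matrix_conjTranspose continuous_id
  have hpos : IsClosed (⋂ x : Fin d → ℝ,
      {A : Matrix (Fin d) (Fin d) ℝ | 0 ≤ star x ⬝ᵥ (A *ᵥ x)}) :=
    isClosed_iInter fun x => isClosed_le continuous_const
      (continuous_const.dotProduct (continuous_id.matrix_mulVec continuous_const))
  have hdet : IsOpen {A : Matrix (Fin d) (Fin d) ℝ | A.det ≠ 0} :=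
    isOpen_ne_fun continuous_id.matrix_det continuous_const
  convert (hsymm.measurableSet.inter hpos.measurableSet).inter hdet.measurableSet using 1
  ext A
  constructor
  · exact fun h => ⟨⟨h.isHermitian, Set.mem_iInter.2 fun x =>
      h.posSemidef.dotProduct_mulVec_nonneg x⟩, h.det_pos.ne'⟩
  · rintro ⟨⟨h1, h2⟩, h3⟩
    exact (PosSemidef.of_dotProduct_mulVec_nonneg h1 fun x =>
      Set.mem_iInter.1 h2 x).posDef_iff_det_ne_zero.2 h3

lemma maskRadius_le_half {η ε δ : ℝ} (hε1 : ε ≤ 1) (hδ : 0 < δ) (hδ1 : δ ≤ 1) :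
    maskRadius d η ε δ ≤ 1 / 2 := by
  have hx : Real.log 2 ≤ Real.log (2 / δ) := by
    refine Real.log_le_log (by norm_num) ?_
    rw [le_div_iff₀ hδ]
    linarith
  have h2 := Real.log_two_gt_d9
  -- Only ε/(8 ln(2/δ)) is needed: it is at most 1/(8 ln 2) < 1/2.
  refine (min_le_right _ _).trans ((min_le_left _ _).trans ?_)
  rw [div_le_iff₀ (by linarith)]
  linarith

lemma maskRadius_nonneg {η ε δ : ℝ} (hη : 0 < η) (hε : 0 < ε) (hδ : 0 < δ) (hδ1 : δ ≤ 1) :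
    0 ≤ maskRadius d η ε δ := by
  have hx : 0 ≤ Real.log (2 / δ) := Real.log_nonneg (by rw [le_div_iff₀ hδ]; linarith)
  refine le_min (le_min ?_ ?_) (le_min ?_ ?_) <;> positivity

lemma epsZero_maskRadius_le {η ε δ : ℝ} (hd : 1 ≤ d) (hη : 0 < η) (hε : 0 < ε) (hδ : 0 < δ)
    (hδ1 : δ ≤ 1) : epsZero d η (maskRadius d η ε δ) δ ≤ ε := by
  have hd0 : (0 : ℝ) < d := by exact_mod_cast hd
  have hx : 0 < Real.log (2 / δ) := Real.log_pos (by rw [lt_div_iff₀ hδ]; linarith)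
  have h0 := maskRadius_nonneg (d := d) hη hε hδ hδ1
  set γ := maskRadius d η ε δ with hγ
  set x := Real.log (2 / δ) with hxdef
  have hsx : 0 < √x := Real.sqrt_pos.2 hx
  have hsd : 0 < √(d : ℝ) := Real.sqrt_pos.2 hd0
  have hc : 0 < 2 * d * (d + 1 / η ^ 2) := by positivity
  have h1 : γ ≤ √(ε / (2 * d * (d + 1 / η ^ 2))) := (min_le_left _ _).trans (min_le_left _ _)
  have h2 : γ ≤ ε / (8 * d * √x) := (min_le_left _ _).trans (min_le_right _ _)
  have h3 : γ ≤ ε / (8 * x) := (min_le_right _ _).trans (min_le_left _ _)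
  have h4 : γ ≤ ε * η / (12 * √d * √x) := (min_le_right _ _).trans (min_le_right _ _)
  have h1' : γ ^ 2 * (2 * d * (d + 1 / η ^ 2)) ≤ ε := by
    rw [← le_div_iff₀ hc, ← Real.sq_sqrt (show 0 ≤ ε / (2 * d * (d + 1 / η ^ 2)) by positivity)]
    exact pow_le_pow_left₀ h0 h1 2
  rw [le_div_iff₀ (by positivity)] at h2 h3 h4
  have h4' : 3 * γ * √d * √x / η ≤ ε / 4 := by
    rw [div_le_iff₀ hη]
    linarith
  simp only [epsZero, ← hxdef]
  linarith

theorem covMechanism_isMaskingMechanism {η ε δ : ℝ} (hd : 1 ≤ d) (hη : 0 < η) (hε : 0 < ε)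
    (hε1 : ε ≤ 1) (hδ : 0 < δ) (hδ1 : δ ≤ 1) :
    IsMaskingMechanism {A : Matrix (Fin d) (Fin d) ℝ | A.PosDef} specDist (covMechanism η)
      (maskRadius d η ε δ) ε δ := by
  refine ⟨fun A hA => ?_, fun A₁ h₁ A₂ h₂ h => ?_⟩
  · have hm : Measurable fun G : Matrix (Fin d) (Fin d) ℝ =>
        CFC.sqrt A * (1 + η • G) * (1 + η • G)ᵀ * CFC.sqrt A :=
      measurable_mul (measurable_mul (measurable_noisy η _)
        (measurable_transpose (measurable_one_add_smul η))) measurable_const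
    refine ⟨Measure.isProbabilityMeasure_map hm.aemeasurable, ?_⟩
    refine (ae_map_iff hm.aemeasurable measurableSet_posDef).2 ?_
    filter_upwards [ae_det_one_add_smul_ne_zero (d := d) hη.ne'] with G hG
    exact posDef_conj (posDef_sqrt hA) hG
  · exact (covMechanism_indistinguishable hη hd h₁ h₂ h (maskRadius_le_half hε1 hδ hδ1) hδ).mono
      (epsZero_maskRadius_le hd hη hε hδ hδ1)

end Masking

end CovMask

theorem mainTheorem8 (d : ℕ) (hd : 1 ≤ d) (η : ℝ) (hη : 0 < η) :
    (∀ A₁ A₂ : Matrix (Fin d) (Fin d) ℝ, A₁.PosDef → A₂.PosDef →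
      ∀ γ : ℝ, CovMask.specDist A₁ A₂ ≤ γ → γ ≤ 1 / 2 → ∀ δ₀ : ℝ, 0 < δ₀ →
        CovMask.Indistinguishable (CovMask.noisyFactor η A₁) (CovMask.noisyFactor η A₂)
          (CovMask.epsZero d η γ δ₀) δ₀ ∧
        CovMask.Indistinguishable (CovMask.covMechanism η A₁) (CovMask.covMechanism η A₂)
          (CovMask.epsZero d η γ δ₀) δ₀) ∧
    (∀ ε δ : ℝ, 0 < ε → ε ≤ 1 → 0 < δ → δ ≤ 1 →
      CovMask.IsMaskingMechanism {A : Matrix (Fin d) (Fin d) ℝ | A.PosDef} CovMask.specDist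
        (CovMask.covMechanism η) (CovMask.maskRadius d η ε δ) ε δ) :=
  ⟨fun _ _ h₁ h₂ _ h hγ _ hδ =>
    ⟨CovMask.noisyFactor_indistinguishable hη hd h₁ h₂ h hγ hδ,
      CovMask.covMechanism_indistinguishable hη hd h₁ h₂ h hγ hδ⟩,
    fun _ _ hε hε1 hδ hδ1 => CovMask.covMechanism_isMaskingMechanism hd hη hε hε1 hδ hδ1⟩
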